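/- Let $\theta,\gamma,\delta,M,N,S,P$ be smooth real functions of $\mu=(\mu_1,\mu_2)$ on an open neighbourhood of $0\in\mathbb R^2$, and consider the planar system $$\dot\xi_1=\xi_1\,g_1,\quad g_1=\mu_1-\theta(\mu)\xi_1+\gamma(\mu)\xi_2-M(\mu)\xi_1\xi_2+N(\mu)\xi_1^2,$$ $$\dot\xi_2=\xi_2\,g_2,\quad g_2=\mu_2-\delta(\mu)\xi_1+\xi_2+S(\mu)\xi_1^2+P(\mu)\xi_2^2.$$ Write $\theta=\theta(0)$, $\gamma=\gamma(0)$, $\delta=\delta(0)$ and assume $\theta\delta\neq0$ and $\theta-\gamma\delta\neq0$. Then, for all sufficiently small $|\mu|$: (i) There are smooth functions $e(\mu)\in\mathbb R$ and $E_3(\mu)\in\mathbb R^2$ such that $\xi_1=e(\mu)$ is the unique solution near $0$ of $\mu_1-\theta(\mu)\xi_1+N(\mu)\xi_1^2=0$, which gives the equilibrium $E_1(\mu)=(e(\mu),0)$, and $E_3(\mu)$ is the unique solution near $(0,0)$ of $g_1=g_2=0$. The set $$T_1=\{\mu : \text{the second coordinate of }E_3(\mu)\text{ is }0,\ \mu_1/\theta>0\}$$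 is the smooth curve $\mu_2=h(\mu_1)$, $\mu_1/\theta>0$, where $h$ is smooth near $0$ and $h(\mu_1)=\frac{\delta}{\theta}\mu_1+O(\mu_1^2)$. (ii) At each $\mu\in T_1$ the points $E_3$ and $E_1$ coincide, with $e(\mu)>0$, and the linearization of the system at this point has the eigenvalues $0$ and $\lambda\ne0$, where $\lambda=-\mu_1+O(\mu_1^2)$. (iii) $T_1$ is a transcritical bifurcation curve. Precisely, let $\mu^0\in T_1$, fix $\mu_1=\mu^0_1$, let $\mu_2$ be the bifurcation parameter, write $f$ for the right-hand side of the system, $\xi^0=E_1(\mu^0)$ and $A=D_\xi f(\xi^0,\mu^0)$. Then Sotomayor's conditions hold: $f(\xi^0,\mu^0)=0$, $0$ is a simple eigenvalue of $A$ and the other eigenvalue is not on the imaginary axis, and there are $v\neq0$, $w\neq0$ with $Av=0$, $w^TA=0$ and $$w^Tf_{\mu_2}=0,\qquad w^T\,(D_\xi f_{\mu_2})\,v\neq0,\qquad w^T\,D_\xi^2f\,(v,v)\neq0\qquad\text{at }(\xi^0,\mu^0).$$ Moreover, for $\mu_2$ near $\mu_2^0$ the equilibria near $\xi^0$ are exactly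 $E_1(\mu^0_1,\mu_2)$ and $E_3(\mu^0_1,\mu_2)$; these two smooth branches coincide only at $\mu_2=\mu_2^0$, where they have different derivatives with respect to $\mu_2$; for $\mu_2\neq\mu^0_2$ both equilibria are hyperbolic, their numbers of eigenvalues with negative real part differ by one, and these two numbers are interchanged between the branches when $\mu_2$ passes through $\mu^0_2$. -/

import Mathlib

open scoped ContDiff

noncomputable section

namespace KolmogorovTranscritical

/-! ### One-parameter families of vector fields `x' = F s x` on a finite-dimensional space -/

section Bifurcation

variable {E : Type*} [NormedAddCommGroup E] [NormedSpace ℝ E] [FiniteDimensional ℝ E]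

/-- The complex eigenvalues of the linearization of the vector field `f` at `x`,
counted with algebraic multiplicity. -/
def eigenvaluesAt (f : E → E) (x : E) : Multiset ℂ :=
  ((LinearMap.charpoly (fderiv ℝ f x : E →ₗ[ℝ] E)).map (algebraMap ℝ ℂ)).roots

/-- No eigenvalue of the linearization lies on the imaginary axis. -/
def IsHyperbolicAt (f : E → E) (x : E) : Prop :=
  ∀ z ∈ eigenvaluesAt f x, z.re ≠ 0

/-- The number of eigenvalues with negative real part. -/
def stableIndex (f : E → E) (x : E) : ℕ :=
  (eigenvaluesAt f x).countP (fun z => z.re < 0)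

/-- The family `x' = F s x` has a transcritical bifurcation at `(x₀, s₀)`, with branches of
equilibria `p` and `q`: near `(x₀, s₀)` the equilibria are exactly the points of two smooth branches
that cross transversally at `(x₀, s₀)` and nowhere else, all equilibria other than `x₀` at `s₀` are
hyperbolic, and the two branches exchange their stability (their numbers of eigenvalues with
negative real part, which differ by one) as `s` passes through `s₀`. -/
structure IsTranscritical (F : ℝ → E → E) (p q : ℝ → E) (x₀ : E) (s₀ : ℝ) : Prop where
  left_base : p s₀ = x₀
  right_base : q s₀ = x₀
  transversal : deriv p s₀ ≠ deriv q s₀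
  local_picture : ∃ ρ > 0, ∃ r > 0,
    ContDiffOn ℝ ∞ p (Set.Ioo (s₀ - ρ) (s₀ + ρ)) ∧
    ContDiffOn ℝ ∞ q (Set.Ioo (s₀ - ρ) (s₀ + ρ)) ∧
    (∀ s ∈ Set.Ioo (s₀ - ρ) (s₀ + ρ),
      p s ∈ Metric.ball x₀ r ∧ q s ∈ Metric.ball x₀ r ∧
      (∀ x ∈ Metric.ball x₀ r, F s x = 0 ↔ x = p s ∨ x = q s) ∧
      (s ≠ s₀ → p s ≠ q s ∧ IsHyperbolicAt (F s) (p s) ∧ IsHyperbolicAt (F s) (q s))) ∧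
    ∃ k l : ℕ, (k = l + 1 ∨ l = k + 1) ∧
      (∀ s ∈ Set.Ioo (s₀ - ρ) s₀, stableIndex (F s) (p s) = k ∧ stableIndex (F s) (q s) = l) ∧
      (∀ s ∈ Set.Ioo s₀ (s₀ + ρ), stableIndex (F s) (p s) = l ∧ stableIndex (F s) (q s) = k)

/-- Sotomayor's conditions for a transcritical bifurcation of `x' = F s x` at `(x₀, s₀)`: `x₀` is
an equilibrium whose linearization `A` has `0` as a simple eigenvalue and no other eigenvalue on the
imaginary axis; with `A v = 0` and `wᵀ A = 0` (the row vector `wᵀ` is a linear functional) one has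
`wᵀ F_s = 0`, `wᵀ (D F_s) v ≠ 0` and `wᵀ D²F (v, v) ≠ 0`. -/
def SotomayorTranscritical (F : ℝ → E → E) (x₀ : E) (s₀ : ℝ) : Prop :=
  F s₀ x₀ = 0 ∧
  (eigenvaluesAt (F s₀) x₀).count 0 = 1 ∧
  (∀ z ∈ eigenvaluesAt (F s₀) x₀, z ≠ 0 → z.re ≠ 0) ∧
  ∃ (v : E) (w : E →L[ℝ] ℝ), v ≠ 0 ∧ w ≠ 0 ∧
    fderiv ℝ (F s₀) x₀ v = 0 ∧
    w.comp (fderiv ℝ (F s₀) x₀) = 0 ∧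
    w (deriv (fun s => F s x₀) s₀) = 0 ∧
    w (deriv (fun s => fderiv ℝ (F s) x₀ v) s₀) ≠ 0 ∧
    w (fderiv ℝ (fun x => fderiv ℝ (F s₀) x v) x₀ v) ≠ 0

end Bifurcation

/-! ### The Kolmogorov system -/

/-- The coefficients of the system, as functions of the parameter `μ = (μ₁, μ₂)`. -/
structure Coeffs where
  θ : ℝ × ℝ → ℝ
  γ : ℝ × ℝ → ℝ
  δ : ℝ × ℝ → ℝ
  M : ℝ × ℝ → ℝ
  N : ℝ × ℝ → ℝ
  S : ℝ × ℝ → ℝ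
  P : ℝ × ℝ → ℝ

namespace Coeffs

variable (c : Coeffs)

/-- All coefficients are smooth on `U`. -/
def SmoothOn (U : Set (ℝ × ℝ)) : Prop :=
  ContDiffOn ℝ ∞ c.θ U ∧ ContDiffOn ℝ ∞ c.γ U ∧ ContDiffOn ℝ ∞ c.δ U ∧
  ContDiffOn ℝ ∞ c.M U ∧ ContDiffOn ℝ ∞ c.N U ∧ ContDiffOn ℝ ∞ c.S U ∧ ContDiffOn ℝ ∞ c.P U

/-- `μ₁ - θ ξ₁ + γ ξ₂ - M ξ₁ ξ₂ + N ξ₁²`. -/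
def g₁ (μ ξ : ℝ × ℝ) : ℝ :=
  μ.1 - c.θ μ * ξ.1 + c.γ μ * ξ.2 - c.M μ * ξ.1 * ξ.2 + c.N μ * ξ.1 ^ 2

/-- `μ₂ - δ ξ₁ + ξ₂ + S ξ₁² + P ξ₂²`. -/
def g₂ (μ ξ : ℝ × ℝ) : ℝ :=
  μ.2 - c.δ μ * ξ.1 + ξ.2 + c.S μ * ξ.1 ^ 2 + c.P μ * ξ.2 ^ 2

/-- The right-hand side of the system: `ξ₁' = ξ₁ g₁`, `ξ₂' = ξ₂ g₂`. -/
def field (μ ξ : ℝ × ℝ) : ℝ × ℝ :=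
  (ξ.1 * c.g₁ μ ξ, ξ.2 * c.g₂ μ ξ)

/-- `e μ` is the first coordinate of the equilibrium `E₁(μ) = (e μ, 0)`: for `|μ| < ε` it is the
only solution in `(-r, r)` of `μ₁ - θ ξ₁ + N ξ₁² = 0`, and it is smooth in `μ`. -/
def IsE₁ (e : ℝ × ℝ → ℝ) (ε r : ℝ) : Prop :=
  ContDiffOn ℝ ∞ e (Metric.ball 0 ε) ∧
  ∀ μ ∈ Metric.ball (0 : ℝ × ℝ) ε, e μ ∈ Set.Ioo (-r) r ∧
    ∀ x ∈ Set.Ioo (-r) r, μ.1 - c.θ μ * x + c.N μ * x ^ 2 = 0 ↔ x = e μ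

/-- `E₃ μ` is the fourth equilibrium: for `|μ| < ε` it is the only common zero of `g₁ μ` and
`g₂ μ` in the ball of radius `r` about the origin, and it is smooth in `μ`. -/
def IsE₃ (E₃ : ℝ × ℝ → ℝ × ℝ) (ε r : ℝ) : Prop :=
  ContDiffOn ℝ ∞ E₃ (Metric.ball 0 ε) ∧
  ∀ μ ∈ Metric.ball (0 : ℝ × ℝ) ε, E₃ μ ∈ Metric.ball (0 : ℝ × ℝ) r ∧
    ∀ ξ ∈ Metric.ball (0 : ℝ × ℝ) r, (c.g₁ μ ξ = 0 ∧ c.g₂ μ ξ = 0) ↔ ξ = E₃ μ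

/-- The curve `T₁` for `|μ| < ε`: the second coordinate of `E₃` vanishes and `μ₁ / θ(0) > 0`. -/
def T₁ (E₃ : ℝ × ℝ → ℝ × ℝ) (ε : ℝ) : Set (ℝ × ℝ) :=
  {μ | μ ∈ Metric.ball (0 : ℝ × ℝ) ε ∧ (E₃ μ).2 = 0 ∧ 0 < μ.1 / c.θ 0}

end Coeffs

end KolmogorovTranscritical

end

open Filter Topology
open scoped ContDiff

/-! Everything is governed by the scalar function `k(μ) = g₂(μ, (e μ, 0))`. At `E₁` the
linearization is upper triangular, with eigenvalues `l = e (-θ + 2 N e)`, along the axis, and `k`.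
Both `e` and `E₃` are implicit functions (`exists_e`, `exists_E₃`). Subtracting the equations of
`E₁` from those of `E₃` and eliminating the difference of first coordinates gives the exact identity
`(E₃)₂ · crossDen = k · crossNum` (`snd_E₃_mul_den`), where `crossNum` is close to `θ(0)` and
`crossDen` to `γ(0)δ(0) - θ(0)`. Hence `T₁` is the part of `k = 0` with `μ₁/θ(0) > 0`. Since `∂k/∂μ₂
= 1` at the origin, this is a graph `μ₂ = h(μ₁)` (`exists_curve`). Fix `μ₁` and let `μ₂` cross the
curve: `k` changes sign with positive speed. The determinant at `E₁` is `l k`, with `l` of the sign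
of `-θ(0)`; the identity shows that the determinant at `E₃` has the sign of `θ(0) k`. So on each
side exactly one of the two equilibria is a saddle, and the other is a sink or a source according to
the sign of `θ(0)` (`hyperbolic_and_index`). Differentiating the same identity separates the
velocities of the branches (`deriv_branches_ne`), and the quadratic Sotomayor coefficient is a
multiple of `crossDen`. -/

namespace KolmogorovTranscritical

/-! ### A smooth implicit function theorem -/

/-- The implicit function theorem in the smooth category: the implicit function is smooth on a whole
neighbourhood of the base point. -/
theorem exists_smooth_implicit {X Y : Type*} [NormedAddCommGroup X] [NormedSpace ℝ X]
    [CompleteSpace X] [NormedAddCommGroup Y] [NormedSpace ℝ Y] [FiniteDimensional ℝ Y]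
    {f : X × Y → Y} {u : X × Y} {A : Y →L[ℝ] Y}
    (hf : ∀ᶠ v in 𝓝 u, ContDiffAt ℝ ∞ f v)
    (hA : HasFDerivAt (fun y => f (u.1, y)) A u.2) (hinj : Function.Injective A) :
    ∃ φ : X → Y, φ u.1 = u.2 ∧ (∀ᶠ x in 𝓝 u.1, ContDiffAt ℝ ∞ φ x) ∧
      ∀ᶠ v in 𝓝 u, f v = f u ↔ v.2 = φ v.1 := by
  have : CompleteSpace Y := FiniteDimensional.complete ℝ Y
  have hfu := hf.self_of_nhds
  have hne : (∞ : WithTop ℕ∞) ≠ 0 := by simp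
  have hpart : fderiv ℝ f u ∘L .inr ℝ X Y = A := by
    have h1 : HasFDerivAt (fun y : Y => (u.1, y)) (ContinuousLinearMap.inr ℝ X Y) u.2 :=
      hasFDerivAt_prodMk_right u.1 u.2
    exact ((hfu.differentiableAt hne).hasFDerivAt.comp u.2 h1).unique hA
  let L : Y ≃L[ℝ] Y := (LinearEquiv.ofInjectiveEndo (A : Y →ₗ[ℝ] Y) hinj).toContinuousLinearEquiv
  have hL : (L : Y →L[ℝ] Y) = A := by ext y; rfl
  have hinv : (fderiv ℝ f u ∘L .inr ℝ X Y).IsInvertible := by rw [hpart]; exact ⟨L, hL⟩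
  have hinv_near : ∀ᶠ v in 𝓝 u, (fderiv ℝ f v ∘L .inr ℝ X Y).IsInvertible := by
    have hc : ContinuousAt (fun v => fderiv ℝ f v ∘L .inr ℝ X Y) u :=
      (hfu.continuousAt_fderiv hne).clm_comp continuousAt_const
    refine hc.eventually ?_
    have := ContinuousLinearEquiv.nhds L
    rw [hL, ← hpart] at this
    filter_upwards [this] with B hB using hB
  set φ := hfu.implicitFunction hne hinv with hφ
  have hφ0 : φ u.1 = u.2 := hfu.implicitFunction_apply_self hne hinv
  have hiff : ∀ᶠ v in 𝓝 u, f v = f u ↔ φ v.1 = v.2 :=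
    hfu.eventually_apply_eq_iff_implicitFunction hne hinv
  -- Order 1 is used because being `C^n` at a point is an open condition only for finite `n` (or
  -- `ω`): for `∞` the neighbourhood may shrink with the order. This is also why `hf` assumes
  -- smoothness near `u`.
  have hφc : ∀ᶠ x in 𝓝 u.1, ContinuousAt φ x := by
    have h1 : ContDiffAt ℝ 1 φ u.1 :=
      (hfu.contDiffAt_implicitFunction hne hinv).of_le (by simp)
    filter_upwards [h1.eventually (by simp)] with x hx using hx.continuousAt
  have hgraph : Tendsto (fun x => (x, φ x)) (𝓝 u.1) (𝓝 u) := by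
    have : ContinuousAt (fun x => (x, φ x)) u.1 := continuousAt_id.prodMk hφc.self_of_nhds
    simpa [ContinuousAt, hφ0] using this
  refine ⟨φ, hφ0, ?_, hiff.mono fun v hv => hv.trans eq_comm⟩
  -- The implicit function is rebuilt at each nearby point of the graph. It is smooth at its own
  -- base point, and local uniqueness identifies it with `φ`.
  filter_upwards [hgraph.eventually hf, hgraph.eventually hinv_near,
    hgraph.eventually hiff.eventually_nhds, hφc] with x hfx hix hex hcx
  have hfx0 : f (x, φ x) = f u := hex.self_of_nhds.2 rfl
  have hψ := hfx.eventually_apply_eq_iff_implicitFunction hne hix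
  have hgx : Tendsto (fun y => (y, φ y)) (𝓝 x) (𝓝 (x, φ x)) := continuousAt_id.prodMk hcx
  refine (hfx.contDiffAt_implicitFunction hne hix).congr_of_eventuallyEq ?_
  filter_upwards [hgx.eventually hψ, hgx.eventually hex] with y h1 h2
  exact (h1.1 ((h2.2 rfl).trans hfx0.symm)).symm

/-! ### Linearizations in the plane -/

/-- The linear map of the plane with matrix `!![a, b; c, d]`. -/
noncomputable def planarMap (a b c d : ℝ) : ℝ × ℝ →L[ℝ] ℝ × ℝ :=
  (a • ContinuousLinearMap.fst ℝ ℝ ℝ + b • ContinuousLinearMap.snd ℝ ℝ ℝ).prod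
    (c • ContinuousLinearMap.fst ℝ ℝ ℝ + d • ContinuousLinearMap.snd ℝ ℝ ℝ)

@[simp]
theorem planarMap_apply (a b c d : ℝ) (v : ℝ × ℝ) :
    planarMap a b c d v = (a * v.1 + b * v.2, c * v.1 + d * v.2) := by
  simp [planarMap]

theorem planarMap_injective {a b c d : ℝ} (h : a * d - b * c ≠ 0) :
    Function.Injective (planarMap a b c d) := by
  rw [injective_iff_map_eq_zero]
  rintro ⟨x, y⟩ hv
  simp only [planarMap_apply, Prod.mk_eq_zero] at hv ⊢
  obtain ⟨h1, h2⟩ := hv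
  constructor
  · refine (mul_eq_zero.1 (?_ : (a * d - b * c) * x = 0)).resolve_left h
    linear_combination d * h1 - b * h2
  · refine (mul_eq_zero.1 (?_ : (a * d - b * c) * y = 0)).resolve_left h
    linear_combination a * h2 - c * h1

theorem charpoly_planarMap (a b c d : ℝ) :
    LinearMap.charpoly (planarMap a b c d : ℝ × ℝ →ₗ[ℝ] ℝ × ℝ) =
      Polynomial.X ^ 2 - Polynomial.C (a + d) * Polynomial.X + Polynomial.C (a * d - b * c) := by
  rw [← LinearMap.charpoly_toMatrix _ (Module.Basis.finTwoProd ℝ), Matrix.charpoly_fin_two]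
  congr 3
  · simp [Matrix.trace_fin_two, LinearMap.toMatrix_apply]
  · rw [Matrix.det_fin_two]
    simp [LinearMap.toMatrix_apply]

/-- The eigenvalues of a planar linearization are two complex numbers, with the trace as their sum
and the determinant as their product. -/
theorem eigenvaluesAt_eq_pair {f : ℝ × ℝ → ℝ × ℝ} {x : ℝ × ℝ} {a b c d : ℝ}
    (hf : HasFDerivAt f (planarMap a b c d) x) {z w : ℂ} (hsum : z + w = ((a + d : ℝ) : ℂ))
    (hprod : z * w = ((a * d - b * c : ℝ) : ℂ)) : eigenvaluesAt f x = {z, w} := by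
  have hpoly : (Polynomial.X ^ 2 - Polynomial.C (a + d) * Polynomial.X +
      Polynomial.C (a * d - b * c)).map (algebraMap ℝ ℂ) =
      (({z, w} : Multiset ℂ).map fun t => Polynomial.X - Polynomial.C t).prod := by
    have h1 : (algebraMap ℝ ℂ) (a + d) = z + w := by rw [hsum]; rfl
    have h2 : (algebraMap ℝ ℂ) (a * d - b * c) = z * w := by rw [hprod]; rfl
    simp only [Polynomial.map_add, Polynomial.map_sub, Polynomial.map_mul, Polynomial.map_pow,
      Polynomial.map_X, Polynomial.map_C, h1, h2, Multiset.insert_eq_cons, Multiset.map_cons,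
      Multiset.prod_cons, Multiset.map_singleton, Multiset.prod_singleton]
    rw [Polynomial.C_add, Polynomial.C_mul]
    ring
  rw [eigenvaluesAt, hf.fderiv, charpoly_planarMap, hpoly, Polynomial.roots_multiset_prod_X_sub_C]

theorem exists_add_eq_mul_eq (t p : ℂ) : ∃ z w : ℂ, z + w = t ∧ z * w = p := by
  obtain ⟨q, hq⟩ := IsAlgClosed.exists_pow_nat_eq (t ^ 2 - 4 * p) (n := 2) (by norm_num)
  exact ⟨(t + q) / 2, (t - q) / 2, by ring, by linear_combination -hq / 4⟩

/-- If two complex numbers have a real sum and a real product, then they are real or share their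
real part. -/
theorem re_mul_re_of_real_sum_prod {z w : ℂ} {t p : ℝ} (hsum : z + w = (t : ℂ))
    (hprod : z * w = (p : ℂ)) :
    z.re + w.re = t ∧ (z.re * w.re = p ∨ z.re = w.re ∧ z.re ^ 2 ≤ p) := by
  have h1 := congrArg Complex.re hsum
  have h2 := congrArg Complex.im hsum
  have h3 := congrArg Complex.re hprod
  have h4 := congrArg Complex.im hprod
  simp only [Complex.add_re, Complex.add_im, Complex.mul_re, Complex.mul_im, Complex.ofReal_re,
    Complex.ofReal_im] at h1 h2 h3 h4
  have hw : w.im = -z.im := by linarith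
  rw [hw] at h3 h4
  refine ⟨h1, ?_⟩
  have h5 : z.im * (w.re - z.re) = 0 := by linarith
  rcases mul_eq_zero.1 h5 with h | h
  · left; rw [h] at h3; linarith
  · right
    have h6 : w.re = z.re := by linarith
    rw [h6] at h3
    exact ⟨h6.symm, by nlinarith [sq_nonneg z.im]⟩

/-! ### Stability index from the signs of determinant and trace. -/

section Index

variable {f : ℝ × ℝ → ℝ × ℝ} {x : ℝ × ℝ} {a b c d : ℝ}

theorem hyperbolic_and_stableIndex_of_pair {z w : ℂ} (h : eigenvaluesAt f x = {z, w})
    (hz : z.re ≠ 0) (hw : w.re ≠ 0) :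
    IsHyperbolicAt f x ∧
      stableIndex f x = (if z.re < 0 then 1 else 0) + (if w.re < 0 then 1 else 0) := by
  constructor
  · intro t ht
    rw [h] at ht
    simp only [Multiset.insert_eq_cons, Multiset.mem_cons, Multiset.mem_singleton] at ht
    rcases ht with rfl | rfl <;> assumption
  · rw [stableIndex, h, Multiset.insert_eq_cons, ← Multiset.cons_zero w]
    rw [Multiset.countP_cons, Multiset.countP_cons, Multiset.countP_zero]
    ring

theorem saddle_of_det_neg (hf : HasFDerivAt f (planarMap a b c d) x) (hdet : a * d - b * c < 0) :
    IsHyperbolicAt f x ∧ stableIndex f x = 1 := by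
  obtain ⟨z, w, hs, hp⟩ := exists_add_eq_mul_eq ((a + d : ℝ) : ℂ) ((a * d - b * c : ℝ) : ℂ)
  obtain ⟨-, h | ⟨-, h⟩⟩ := re_mul_re_of_real_sum_prod hs hp
  -- Eigenvalues with a common real part would have `z.re ^ 2 ≤ det < 0`, so only the case of real
  -- parts with product `det` survives.
  swap
  · nlinarith [sq_nonneg z.re]
  have hneg : z.re * w.re < 0 := h ▸ hdet
  have hpair := hyperbolic_and_stableIndex_of_pair (eigenvaluesAt_eq_pair hf hs hp)
    (fun h0 => by simp [h0] at hneg) (fun h0 => by simp [h0] at hneg)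
  refine ⟨hpair.1, hpair.2.trans ?_⟩
  rcases mul_neg_iff.1 hneg with ⟨h1, h2⟩ | ⟨h1, h2⟩
  · simp [h2, h1.le]
  · simp [h1, h2.le]

theorem sink_of_det_pos_of_trace_neg (hf : HasFDerivAt f (planarMap a b c d) x)
    (hdet : 0 < a * d - b * c) (htr : a + d < 0) :
    IsHyperbolicAt f x ∧ stableIndex f x = 2 := by
  obtain ⟨z, w, hs, hp⟩ := exists_add_eq_mul_eq ((a + d : ℝ) : ℂ) ((a * d - b * c : ℝ) : ℂ)
  obtain ⟨hsum, h⟩ := re_mul_re_of_real_sum_prod hs hp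
  have hre : z.re < 0 ∧ w.re < 0 := by
    rcases h with h | ⟨h, -⟩
    · rcases mul_pos_iff.1 (h ▸ hdet) with h1 | h1
      · linarith
      · exact h1
    · constructor <;> linarith
  have hpair := hyperbolic_and_stableIndex_of_pair (eigenvaluesAt_eq_pair hf hs hp)
    hre.1.ne hre.2.ne
  exact ⟨hpair.1, hpair.2.trans (by simp [hre.1, hre.2])⟩

theorem source_of_det_pos_of_trace_pos (hf : HasFDerivAt f (planarMap a b c d) x)
    (hdet : 0 < a * d - b * c) (htr : 0 < a + d) :
    IsHyperbolicAt f x ∧ stableIndex f x = 0 := by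
  obtain ⟨z, w, hs, hp⟩ := exists_add_eq_mul_eq ((a + d : ℝ) : ℂ) ((a * d - b * c : ℝ) : ℂ)
  obtain ⟨hsum, h⟩ := re_mul_re_of_real_sum_prod hs hp
  have hre : 0 < z.re ∧ 0 < w.re := by
    rcases h with h | ⟨h, -⟩
    · rcases mul_pos_iff.1 (h ▸ hdet) with h1 | h1
      · exact h1
      · linarith
    · constructor <;> linarith
  have hpair := hyperbolic_and_stableIndex_of_pair (eigenvaluesAt_eq_pair hf hs hp)
    hre.1.ne' hre.2.ne'
  exact ⟨hpair.1, hpair.2.trans (by simp [hre.1.le, hre.2.le])⟩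

end Index

namespace Coeffs

variable (c : Coeffs)

/-! ### Derivatives of the Kolmogorov field -/

theorem hasFDerivAt_g₁ (μ ξ : ℝ × ℝ) :
    HasFDerivAt (c.g₁ μ)
      ((-c.θ μ - c.M μ * ξ.2 + 2 * c.N μ * ξ.1) • ContinuousLinearMap.fst ℝ ℝ ℝ +
        (c.γ μ - c.M μ * ξ.1) • ContinuousLinearMap.snd ℝ ℝ ℝ) ξ := by
  have h1 : HasFDerivAt Prod.fst (ContinuousLinearMap.fst ℝ ℝ ℝ) ξ := hasFDerivAt_fst
  have h2 : HasFDerivAt Prod.snd (ContinuousLinearMap.snd ℝ ℝ ℝ) ξ := hasFDerivAt_snd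
  refine (((((h1.const_mul (c.θ μ)).const_sub μ.1).add (h2.const_mul (c.γ μ))).sub
    ((h1.const_mul (c.M μ)).mul h2)).add ((h1.pow 2).const_mul (c.N μ))).congr_fderiv ?_
  ext
  · simp
    ring
  · simp

theorem hasFDerivAt_g₂ (μ ξ : ℝ × ℝ) :
    HasFDerivAt (c.g₂ μ)
      ((-c.δ μ + 2 * c.S μ * ξ.1) • ContinuousLinearMap.fst ℝ ℝ ℝ +
        (1 + 2 * c.P μ * ξ.2) • ContinuousLinearMap.snd ℝ ℝ ℝ) ξ := by
  have h1 : HasFDerivAt Prod.fst (ContinuousLinearMap.fst ℝ ℝ ℝ) ξ := hasFDerivAt_fst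
  have h2 : HasFDerivAt Prod.snd (ContinuousLinearMap.snd ℝ ℝ ℝ) ξ := hasFDerivAt_snd
  refine (((((h1.const_mul (c.δ μ)).const_sub μ.2).add h2).add
    ((h1.pow 2).const_mul (c.S μ))).add ((h2.pow 2).const_mul (c.P μ))).congr_fderiv ?_
  ext <;> simp <;> ring

theorem hasFDerivAt_g (μ ξ : ℝ × ℝ) :
    HasFDerivAt (fun ξ => (c.g₁ μ ξ, c.g₂ μ ξ))
      (planarMap (-c.θ μ - c.M μ * ξ.2 + 2 * c.N μ * ξ.1) (c.γ μ - c.M μ * ξ.1)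
        (-c.δ μ + 2 * c.S μ * ξ.1) (1 + 2 * c.P μ * ξ.2)) ξ :=
  (c.hasFDerivAt_g₁ μ ξ).prodMk (c.hasFDerivAt_g₂ μ ξ)

theorem hasFDerivAt_field (μ ξ : ℝ × ℝ) :
    HasFDerivAt (c.field μ)
      (planarMap (c.g₁ μ ξ + ξ.1 * (-c.θ μ - c.M μ * ξ.2 + 2 * c.N μ * ξ.1))
        (ξ.1 * (c.γ μ - c.M μ * ξ.1)) (ξ.2 * (-c.δ μ + 2 * c.S μ * ξ.1))
        (c.g₂ μ ξ + ξ.2 * (1 + 2 * c.P μ * ξ.2))) ξ := by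
  have h1 : HasFDerivAt Prod.fst (ContinuousLinearMap.fst ℝ ℝ ℝ) ξ := hasFDerivAt_fst
  have h2 : HasFDerivAt Prod.snd (ContinuousLinearMap.snd ℝ ℝ ℝ) ξ := hasFDerivAt_snd
  refine ((h1.mul (c.hasFDerivAt_g₁ μ ξ)).prodMk (h2.mul (c.hasFDerivAt_g₂ μ ξ))).congr_fderiv ?_
  ext <;> simp <;> ring

theorem fderiv_field_apply (μ ξ v : ℝ × ℝ) :
    fderiv ℝ (c.field μ) ξ v =
      ((c.g₁ μ ξ + ξ.1 * (-c.θ μ - c.M μ * ξ.2 + 2 * c.N μ * ξ.1)) * v.1 +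
          ξ.1 * (c.γ μ - c.M μ * ξ.1) * v.2,
        ξ.2 * (-c.δ μ + 2 * c.S μ * ξ.1) * v.1 +
          (c.g₂ μ ξ + ξ.2 * (1 + 2 * c.P μ * ξ.2)) * v.2) := by
  rw [(c.hasFDerivAt_field μ ξ).fderiv, planarMap_apply]

/-! ### Smoothness in the parameters -/

/-- All coefficients are smooth at `μ`. -/
def SmoothAt (μ : ℝ × ℝ) : Prop :=
  ContDiffAt ℝ ∞ c.θ μ ∧ ContDiffAt ℝ ∞ c.γ μ ∧ ContDiffAt ℝ ∞ c.δ μ ∧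
  ContDiffAt ℝ ∞ c.M μ ∧ ContDiffAt ℝ ∞ c.N μ ∧ ContDiffAt ℝ ∞ c.S μ ∧ ContDiffAt ℝ ∞ c.P μ

variable {c}

theorem SmoothOn.smoothAt {U : Set (ℝ × ℝ)} (hc : c.SmoothOn U) (hU : IsOpen U) {μ : ℝ × ℝ}
    (hμ : μ ∈ U) : c.SmoothAt μ := by
  obtain ⟨h1, h2, h3, h4, h5, h6, h7⟩ := hc
  have hn := hU.mem_nhds hμ
  exact ⟨h1.contDiffAt hn, h2.contDiffAt hn, h3.contDiffAt hn, h4.contDiffAt hn,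
    h5.contDiffAt hn, h6.contDiffAt hn, h7.contDiffAt hn⟩

section Comp

variable {X : Type*} [NormedAddCommGroup X] [NormedSpace ℝ X] {m ξ : X → ℝ × ℝ} {x : X}

theorem SmoothAt.g₁_comp (h : c.SmoothAt (m x)) (hm : ContDiffAt ℝ ∞ m x)
    (hξ : ContDiffAt ℝ ∞ ξ x) : ContDiffAt ℝ ∞ (fun x => c.g₁ (m x) (ξ x)) x := by
  obtain ⟨h1, h2, h3, h4, h5, h6, h7⟩ := h
  unfold g₁
  have := h1.comp x hm
  have := h2.comp x hm
  have := h4.comp x hm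
  have := h5.comp x hm
  simp only [Function.comp_def] at *
  fun_prop

theorem SmoothAt.g₂_comp (h : c.SmoothAt (m x)) (hm : ContDiffAt ℝ ∞ m x)
    (hξ : ContDiffAt ℝ ∞ ξ x) : ContDiffAt ℝ ∞ (fun x => c.g₂ (m x) (ξ x)) x := by
  obtain ⟨h1, h2, h3, h4, h5, h6, h7⟩ := h
  unfold g₂
  have := h3.comp x hm
  have := h6.comp x hm
  have := h7.comp x hm
  simp only [Function.comp_def] at *
  fun_prop

end Comp

/-! ### The equilibria and the curve, as implicit functions -/

theorem exists_e (hs : ∀ᶠ μ in 𝓝 0, c.SmoothAt μ) (hθ : c.θ 0 ≠ 0) :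
    ∃ e : ℝ × ℝ → ℝ, e 0 = 0 ∧ (∀ᶠ μ in 𝓝 0, ContDiffAt ℝ ∞ e μ) ∧
      ∀ᶠ v in 𝓝 (0 : (ℝ × ℝ) × ℝ), c.g₁ v.1 (v.2, 0) = 0 ↔ v.2 = e v.1 := by
  have hsm : ∀ᶠ v in 𝓝 (0 : (ℝ × ℝ) × ℝ),
      ContDiffAt ℝ ∞ (fun v : (ℝ × ℝ) × ℝ => c.g₁ v.1 (v.2, 0)) v := by
    have : Tendsto Prod.fst (𝓝 (0 : (ℝ × ℝ) × ℝ)) (𝓝 0) := continuousAt_fst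
    filter_upwards [this.eventually hs] with v hv
    exact hv.g₁_comp contDiffAt_fst (contDiffAt_snd.prodMk contDiffAt_const)
  have hd : HasFDerivAt (fun y : ℝ => c.g₁ 0 (y, 0))
      ((-c.θ 0) • ContinuousLinearMap.id ℝ ℝ) 0 := by
    have h1 : HasFDerivAt (fun y : ℝ => (y, (0 : ℝ))) (ContinuousLinearMap.inl ℝ ℝ ℝ) 0 :=
      hasFDerivAt_prodMk_left 0 0
    refine (HasFDerivAt.comp (f := fun y : ℝ => (y, (0 : ℝ))) (0 : ℝ)
      (c.hasFDerivAt_g₁ 0 (0, 0)) h1).congr_fderiv ?_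
    ext; simp
  obtain ⟨e, he0, hes, hiff⟩ := exists_smooth_implicit (u := (0 : (ℝ × ℝ) × ℝ)) hsm hd
    (fun x y hxy => by simpa [hθ] using hxy)
  refine ⟨e, he0, hes, ?_⟩
  simpa [g₁] using hiff

/-- The Jacobian of `(g₁, g₂)` in `ξ` at the origin is `!![-θ, γ; -δ, 1]`, with determinant `-(θ -
γδ)`. -/
theorem exists_E₃ (hs : ∀ᶠ μ in 𝓝 0, c.SmoothAt μ) (hdet : c.θ 0 - c.γ 0 * c.δ 0 ≠ 0) :
    ∃ E₃ : ℝ × ℝ → ℝ × ℝ, E₃ 0 = 0 ∧ (∀ᶠ μ in 𝓝 0, ContDiffAt ℝ ∞ E₃ μ) ∧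
      ∀ᶠ v in 𝓝 (0 : (ℝ × ℝ) × (ℝ × ℝ)), (c.g₁ v.1 v.2 = 0 ∧ c.g₂ v.1 v.2 = 0) ↔ v.2 = E₃ v.1 := by
  have hsm : ∀ᶠ v in 𝓝 (0 : (ℝ × ℝ) × (ℝ × ℝ)), ContDiffAt ℝ ∞
      (fun v : (ℝ × ℝ) × (ℝ × ℝ) => (c.g₁ v.1 v.2, c.g₂ v.1 v.2)) v := by
    have : Tendsto Prod.fst (𝓝 (0 : (ℝ × ℝ) × (ℝ × ℝ))) (𝓝 0) := continuousAt_fst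
    filter_upwards [this.eventually hs] with v hv
    exact (hv.g₁_comp contDiffAt_fst contDiffAt_snd).prodMk
      (hv.g₂_comp contDiffAt_fst contDiffAt_snd)
  obtain ⟨E₃, h0, hes, hiff⟩ := exists_smooth_implicit (u := (0 : (ℝ × ℝ) × (ℝ × ℝ))) hsm
    (c.hasFDerivAt_g 0 0) (planarMap_injective (by
      simp only [Prod.fst_zero, Prod.snd_zero, mul_zero, sub_zero, add_zero, mul_one]
      contrapose! hdet
      linarith))
  refine ⟨E₃, h0, hes, ?_⟩
  simpa [g₁, g₂] using hiff

/-- The derivative of `g₂` at a fixed point of the `ξ₁`-axis with respect to `μ₂`. -/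
theorem hasDerivAt_g₂_param (c : Coeffs) {μ : ℝ × ℝ} (h : c.SmoothAt μ) (x : ℝ) :
    HasDerivAt (fun s => c.g₂ (μ.1, s) (x, 0))
      (1 - fderiv ℝ c.δ μ (0, 1) * x + fderiv ℝ c.S μ (0, 1) * x ^ 2) μ.2 := by
  have hl : HasDerivAt (fun s : ℝ => (μ.1, s)) ((0 : ℝ), (1 : ℝ)) μ.2 :=
    (hasDerivAt_const _ _).prodMk (hasDerivAt_id _)
  have hδ : HasDerivAt (fun s => c.δ (μ.1, s)) (fderiv ℝ c.δ μ (0, 1)) μ.2 :=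
    (h.2.2.1.differentiableAt (by simp)).hasFDerivAt.comp_hasDerivAt μ.2 hl
  have hS : HasDerivAt (fun s => c.S (μ.1, s)) (fderiv ℝ c.S μ (0, 1)) μ.2 :=
    (h.2.2.2.2.2.1.differentiableAt (by simp)).hasFDerivAt.comp_hasDerivAt μ.2 hl
  refine (((hasDerivAt_id μ.2).sub (hδ.mul_const x)).add
    (hS.mul_const (x ^ 2))).congr_of_eventuallyEq (Eventually.of_forall fun s => ?_)
  simp [g₂]

section Curve

variable {e : ℝ × ℝ → ℝ} (hs : ∀ᶠ μ in 𝓝 0, c.SmoothAt μ) (he0 : e 0 = 0)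
  (hes : ∀ᶠ μ in 𝓝 0, ContDiffAt ℝ ∞ e μ)
  (hiff : ∀ᶠ v in 𝓝 (0 : (ℝ × ℝ) × ℝ), c.g₁ v.1 (v.2, 0) = 0 ↔ v.2 = e v.1)

include hs hes in
theorem eventually_contDiffAt_g₂_e :
    ∀ᶠ μ in 𝓝 0, ContDiffAt ℝ ∞ (fun ν => c.g₂ ν (e ν, 0)) μ := by
  filter_upwards [hs, hes] with μ h1 h2
  exact h1.g₂_comp contDiffAt_id (h2.prodMk contDiffAt_const)

include he0 hes hiff in
theorem eventually_g₁_e : ∀ᶠ μ in 𝓝 0, c.g₁ μ (e μ, 0) = 0 := by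
  have h1 : ContinuousAt (fun μ => (μ, e μ)) 0 :=
    continuousAt_id.prodMk hes.self_of_nhds.continuousAt
  have h2 : Tendsto (fun μ => (μ, e μ)) (𝓝 0) (𝓝 (0 : (ℝ × ℝ) × ℝ)) := by
    rw [ContinuousAt, he0] at h1
    exact h1
  filter_upwards [h2.eventually hiff] with μ hμ using hμ.2 rfl

-- For `μ₁ = 0` the point `ξ₁ = 0` solves the axis equation, so `e (0, s) = 0` and `g₂` reduces to
-- `s`.
include hiff in
theorem hasDerivAt_g₂_e_zero : HasDerivAt (fun s : ℝ => c.g₂ (0, s) (e (0, s), 0)) 1 0 := by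
  have h1 : Tendsto (fun s : ℝ => (((0 : ℝ), s), (0 : ℝ))) (𝓝 0) (𝓝 0) :=
    Continuous.tendsto' (by fun_prop) _ _ rfl
  refine (hasDerivAt_id (0 : ℝ)).congr_of_eventuallyEq ?_
  filter_upwards [h1.eventually hiff] with s hs
  have : (0 : ℝ) = e (0, s) := hs.1 (by simp [g₁])
  simp [g₂, ← this]

include hs he0 hes hiff in
theorem exists_curve (hθ : c.θ 0 ≠ 0) :
    ∃ h : ℝ → ℝ, (∀ᶠ t in 𝓝 0, ContDiffAt ℝ ∞ h t) ∧
      (∀ᶠ μ in 𝓝 (0 : ℝ × ℝ), c.g₂ μ (e μ, 0) = 0 ↔ μ.2 = h μ.1) ∧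
      ∃ K : ℝ, ∀ᶠ t in 𝓝 0, |h t - c.δ 0 / c.θ 0 * t| ≤ K * t ^ 2 := by
  obtain ⟨h, h0, hhs, hh⟩ := exists_smooth_implicit (u := (0 : ℝ × ℝ))
    (eventually_contDiffAt_g₂_e hs hes) (hasDerivAt_g₂_e_zero hiff).hasFDerivAt
    (fun x y hxy => by simpa using hxy)
  simp only [Prod.fst_zero, Prod.snd_zero] at h0 hhs
  have hh' : ∀ᶠ μ in 𝓝 (0 : ℝ × ℝ), c.g₂ μ (e μ, 0) = 0 ↔ μ.2 = h μ.1 := by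
    simpa [g₂, he0] using hh
  refine ⟨h, hhs, hh', ?_⟩
  set Γ : ℝ → ℝ × ℝ := fun t => (t, h t) with hΓ
  have hΓ0 : Γ 0 = 0 := by simp [hΓ, h0]
  have hΓd : DifferentiableAt ℝ Γ 0 :=
    differentiableAt_id.prodMk (hhs.self_of_nhds.differentiableAt (by simp))
  have hΓt : Tendsto Γ (𝓝 0) (𝓝 0) := by simpa [ContinuousAt, hΓ0] using hΓd.continuousAt
  have hdiff : ∀ f : ℝ × ℝ → ℝ, ContDiffAt ℝ ∞ f 0 → DifferentiableAt ℝ (fun t => f (Γ t)) 0 := by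
    intro f hf
    have : DifferentiableAt ℝ f (Γ 0) := hΓ0 ▸ hf.differentiableAt (by simp)
    exact this.comp 0 hΓd
  obtain ⟨h1, h2, h3, h4, h5, h6, h7⟩ := hs.self_of_nhds
  have d1 := hdiff _ h1
  have d3 := hdiff _ h3
  have d5 := hdiff _ h5
  have d6 := hdiff _ h6
  have de := hdiff _ hes.self_of_nhds
  -- On the curve `e (θ - N e) = μ₁` and `e (δ - S e) = μ₂`. Eliminating the factor `e` gives `h t =
  -- t * Q t`, and differentiability of `Q` at `0` yields the quadratic error.
  set Q : ℝ → ℝ := fun t =>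
    (c.δ (Γ t) - c.S (Γ t) * e (Γ t)) / (c.θ (Γ t) - c.N (Γ t) * e (Γ t)) with hQ
  have hden0 : c.θ (Γ 0) - c.N (Γ 0) * e (Γ 0) ≠ 0 := by simpa [hΓ0, he0] using hθ
  have hQd : DifferentiableAt ℝ Q 0 := (d3.sub (d6.mul de)).div (d1.sub (d5.mul de)) hden0
  have hQ0 : Q 0 = c.δ 0 / c.θ 0 := by simp [hQ, hΓ0, he0]
  have hden : ∀ᶠ t in 𝓝 0, c.θ (Γ t) - c.N (Γ t) * e (Γ t) ≠ 0 :=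
    (d1.sub (d5.mul de)).continuousAt.eventually_ne hden0
  obtain ⟨K, hK⟩ := hQd.isBigO_sub.bound
  refine ⟨K, ?_⟩
  filter_upwards [hK, hden, hΓt.eventually hh', hΓt.eventually (eventually_g₁_e he0 hes hiff)]
    with t hKt hdt hgt h1t
  have hg2 : c.g₂ (Γ t) (e (Γ t), 0) = 0 := hgt.2 rfl
  have key : h t = t * Q t := by
    simp only [g₁, g₂] at h1t hg2
    rw [hQ]
    simp only
    rw [mul_div_assoc', eq_div_iff hdt]
    have e1 : (Γ t).1 = t := rfl
    have e2 : (Γ t).2 = h t := rfl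
    rw [e1] at h1t
    rw [e2] at hg2
    linear_combination (c.θ (Γ t) - c.N (Γ t) * e (Γ t)) * hg2
      - (c.δ (Γ t) - c.S (Γ t) * e (Γ t)) * h1t
  rw [hQ0] at hKt
  simp only [Real.norm_eq_abs, sub_zero] at hKt
  calc |h t - c.δ 0 / c.θ 0 * t| = |t| * |Q t - c.δ 0 / c.θ 0| := by
        rw [key, ← abs_mul]; congr 1; ring
    _ ≤ |t| * (K * |t|) := by gcongr
    _ = K * t ^ 2 := by rw [← sq_abs t]; ring

end Curve

end Coeffs

namespace Coeffs

/-! ### The crossing of the two branches -/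

section Crossing

variable (c : Coeffs) (e : ℝ × ℝ → ℝ) (E₃ : ℝ × ℝ → ℝ × ℝ) (μ : ℝ × ℝ)

/-- The numerator of the factor by which `E₃` leaves the axis relative to `g₂` along `E₁`. -/
def crossNum : ℝ := c.θ μ - c.N μ * ((E₃ μ).1 + e μ)

/-- The denominator of the factor by which `E₃` leaves the axis relative to `g₂` along `E₁`. -/
def crossDen : ℝ :=
  (c.γ μ - c.M μ * (E₃ μ).1) * (c.δ μ - c.S μ * ((E₃ μ).1 + e μ)) -
    (c.θ μ - c.N μ * ((E₃ μ).1 + e μ)) * (1 + c.P μ * (E₃ μ).2)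

/-- The Jacobian determinant of `(g₁, g₂)` at `E₃`. -/
def jacE₃ : ℝ :=
  (-c.θ μ - c.M μ * (E₃ μ).2 + 2 * c.N μ * (E₃ μ).1) * (1 + 2 * c.P μ * (E₃ μ).2) -
    (c.γ μ - c.M μ * (E₃ μ).1) * (-c.δ μ + 2 * c.S μ * (E₃ μ).1)

/-- The conditions on a small parameter `μ` under which the crossing of `E₁` and `E₃` is
nondegenerate. -/
structure Regular : Prop where
  smooth : c.SmoothAt μ
  smooth_e : ContDiffAt ℝ ∞ e μ
  smooth_E₃ : ContDiffAt ℝ ∞ E₃ μ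
  g₁_e : c.g₁ μ (e μ, 0) = 0
  g₁_E₃ : c.g₁ μ (E₃ μ) = 0
  g₂_E₃ : c.g₂ μ (E₃ μ) = 0
  num_pos : 0 < c.θ 0 * c.crossNum e E₃ μ
  den_jac_pos : 0 < c.crossDen e E₃ μ * c.jacE₃ E₃ μ
  secant_large : c.θ 0 ^ 2 / 2 < c.θ 0 * (c.θ μ - c.N μ * e μ)
  tangent_pos : 0 < c.θ 0 * (c.θ μ - 2 * c.N μ * e μ)
  N_bound : |c.N μ| < |c.N 0| + 1
  deriv_total_pos : 0 < fderiv ℝ (fun ν => c.g₂ ν (e ν, 0)) μ (0, 1)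
  deriv_param_pos : 0 < 1 - fderiv ℝ c.δ μ (0, 1) * e μ + fderiv ℝ c.S μ (0, 1) * e μ ^ 2

variable {c e E₃ μ}

/-- The inequalities are strict and continuous in `μ`, so it suffices to check `μ = 0`. There the
two sign products are `θ²` and `(θ - γδ)²`, the secant and tangent terms are `θ²`, and both
derivatives equal `1`. The factor `θ(0)` treats both signs of `θ(0)` at once. -/
theorem eventually_regular (hs : ∀ᶠ μ in 𝓝 0, c.SmoothAt μ) (hθ : c.θ 0 ≠ 0)
    (hdet : c.θ 0 - c.γ 0 * c.δ 0 ≠ 0) (he0 : e 0 = 0)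
    (hes : ∀ᶠ μ in 𝓝 0, ContDiffAt ℝ ∞ e μ)
    (hiff : ∀ᶠ v in 𝓝 (0 : (ℝ × ℝ) × ℝ), c.g₁ v.1 (v.2, 0) = 0 ↔ v.2 = e v.1)
    (hE0 : E₃ 0 = 0) (hEs : ∀ᶠ μ in 𝓝 0, ContDiffAt ℝ ∞ E₃ μ)
    (hEiff : ∀ᶠ v in 𝓝 (0 : (ℝ × ℝ) × (ℝ × ℝ)),
      (c.g₁ v.1 v.2 = 0 ∧ c.g₂ v.1 v.2 = 0) ↔ v.2 = E₃ v.1) :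
    ∀ᶠ μ in 𝓝 0, c.Regular e E₃ μ := by
  obtain ⟨s1, s2, s3, s4, s5, s6, s7⟩ := hs.self_of_nhds
  have ce := hes.self_of_nhds.continuousAt
  have cE := hEs.self_of_nhds.continuousAt
  have c1 := s1.continuousAt
  have c2 := s2.continuousAt
  have c3 := s3.continuousAt
  have c4 := s4.continuousAt
  have c5 := s5.continuousAt
  have c6 := s6.continuousAt
  have c7 := s7.continuousAt
  have cE1 : ContinuousAt (fun μ => (E₃ μ).1) 0 := cE.fst
  have cE2 : ContinuousAt (fun μ => (E₃ μ).2) 0 := cE.snd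
  have cdir : ∀ f : ℝ × ℝ → ℝ, ContDiffAt ℝ ∞ f 0 →
      ContinuousAt (fun μ => fderiv ℝ f μ (0, 1)) 0 := fun f hf =>
    (hf.continuousAt_fderiv (by simp)).clm_apply continuousAt_const
  have cd3 := cdir _ s3
  have cd6 := cdir _ s6
  have hk := eventually_contDiffAt_g₂_e hs hes
  have cdk := cdir _ hk.self_of_nhds
  have hgraph : Tendsto (fun μ => (μ, E₃ μ)) (𝓝 0) (𝓝 (0 : (ℝ × ℝ) × (ℝ × ℝ))) := by
    have : ContinuousAt (fun μ => (μ, E₃ μ)) 0 := continuousAt_id.prodMk cE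
    rw [ContinuousAt, hE0] at this
    exact this
  have hθ2 : 0 < c.θ 0 ^ 2 := by positivity
  have hdet2 : 0 < (c.θ 0 - c.γ 0 * c.δ 0) ^ 2 := by positivity
  have hdk : fderiv ℝ (fun ν => c.g₂ ν (e ν, 0)) 0 (0, 1) = 1 := by
    have hl : HasDerivAt (fun s : ℝ => ((0 : ℝ), s)) ((0 : ℝ), (1 : ℝ)) 0 :=
      (hasDerivAt_const _ _).prodMk (hasDerivAt_id _)
    exact (HasFDerivAt.comp_hasDerivAt (f := fun s : ℝ => ((0 : ℝ), s)) (0 : ℝ)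
      (hk.self_of_nhds.differentiableAt (by simp)).hasFDerivAt hl).unique
      (hasDerivAt_g₂_e_zero hiff)
  have v1 : ∀ᶠ μ in 𝓝 0, 0 < c.θ 0 * c.crossNum e E₃ μ := by
    have hcont : ContinuousAt (fun μ => c.θ 0 * c.crossNum e E₃ μ) 0 := by
      unfold crossNum; fun_prop
    refine hcont.eventually_const_lt ?_
    simp only [crossNum, he0, hE0, Prod.fst_zero]
    nlinarith
  have v2 : ∀ᶠ μ in 𝓝 0, 0 < c.crossDen e E₃ μ * c.jacE₃ E₃ μ := by
    have hcont : ContinuousAt (fun μ => c.crossDen e E₃ μ * c.jacE₃ E₃ μ) 0 := by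
      unfold crossDen jacE₃; fun_prop
    refine hcont.eventually_const_lt ?_
    simp only [crossDen, jacE₃, he0, hE0, Prod.fst_zero, Prod.snd_zero]
    nlinarith
  have v3 : ∀ᶠ μ in 𝓝 0, c.θ 0 ^ 2 / 2 < c.θ 0 * (c.θ μ - c.N μ * e μ) := by
    have hcont : ContinuousAt (fun μ => c.θ 0 * (c.θ μ - c.N μ * e μ)) 0 := by fun_prop
    refine hcont.eventually_const_lt ?_
    simp only [he0]
    nlinarith
  have v4 : ∀ᶠ μ in 𝓝 0, 0 < c.θ 0 * (c.θ μ - 2 * c.N μ * e μ) := by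
    have hcont : ContinuousAt (fun μ => c.θ 0 * (c.θ μ - 2 * c.N μ * e μ)) 0 := by fun_prop
    refine hcont.eventually_const_lt ?_
    simp only [he0]
    nlinarith
  have v5 : ∀ᶠ μ in 𝓝 0, |c.N μ| < |c.N 0| + 1 :=
    c5.abs.eventually_lt_const (lt_add_one _)
  have v6 : ∀ᶠ μ in 𝓝 0, 0 < fderiv ℝ (fun ν => c.g₂ ν (e ν, 0)) μ (0, 1) :=
    cdk.eventually_const_lt (by simp only [hdk]; exact one_pos)
  have v7 : ∀ᶠ μ in 𝓝 0,
      0 < 1 - fderiv ℝ c.δ μ (0, 1) * e μ + fderiv ℝ c.S μ (0, 1) * e μ ^ 2 := by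
    have hcont : ContinuousAt (fun μ =>
        1 - fderiv ℝ c.δ μ (0, 1) * e μ + fderiv ℝ c.S μ (0, 1) * e μ ^ 2) 0 :=
      (continuousAt_const.sub (cd3.mul ce)).add (cd6.mul (ce.pow 2))
    refine hcont.eventually_const_lt ?_
    simp [he0]
  filter_upwards [hs, hes, hEs, eventually_g₁_e he0 hes hiff, hgraph.eventually hEiff, v1, v2, v3,
    v4, v5, v6, v7] with μ w1 w2 w3 w4 w5 w6 w7 w8 w9 w10 w11 w12
  exact ⟨w1, w2, w3, w4, (w5.2 rfl).1, (w5.2 rfl).2, w6, w7, w8, w9, w10, w11, w12⟩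

namespace Regular

variable (H : c.Regular e E₃ μ)

include H

theorem θ_ne_zero : c.θ 0 ≠ 0 := fun h => by simpa [h] using H.num_pos

theorem num_ne_zero : c.crossNum e E₃ μ ≠ 0 := fun h => by simpa [h] using H.num_pos

theorem den_ne_zero : c.crossDen e E₃ μ ≠ 0 := fun h => by simpa [h] using H.den_jac_pos

/-- The height of `E₃` over the axis is a nonzero multiple of `g₂` at `E₁`. -/
theorem snd_E₃_mul_den :
    (E₃ μ).2 * c.crossDen e E₃ μ = c.g₂ μ (e μ, 0) * c.crossNum e E₃ μ := by
  have h1 := H.g₁_e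
  have h2 := H.g₁_E₃
  have h3 := H.g₂_E₃
  simp only [g₁, g₂, crossNum, crossDen] at *
  -- With `ξ = E₃`, the difference of the `g₁` equations is `-(ξ₁ - e)(θ - N(ξ₁ + e)) + ξ₂(γ - M
  -- ξ₁)`, and that of `g₂` is `-(ξ₁ - e)(δ - S(ξ₁ + e)) + ξ₂(1 + P ξ₂)`. The combination cancels
  -- `ξ₁ - e`.
  linear_combination (c.δ μ - c.S μ * ((E₃ μ).1 + e μ)) * (h2 - h1)
    - (c.θ μ - c.N μ * ((E₃ μ).1 + e μ)) * h3

theorem snd_E₃_eq_zero_iff : (E₃ μ).2 = 0 ↔ c.g₂ μ (e μ, 0) = 0 := by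
  have h := H.snd_E₃_mul_den
  constructor
  · intro h0
    rw [h0, zero_mul, eq_comm, mul_eq_zero] at h
    exact h.resolve_right H.num_ne_zero
  · intro h0
    rw [h0, zero_mul, mul_eq_zero] at h
    exact h.resolve_right H.den_ne_zero

theorem e_mul_secant : e μ * (c.θ μ - c.N μ * e μ) = μ.1 := by
  have h := H.g₁_e
  simp only [g₁] at h
  linear_combination -h

/-- In `e (θ - N e) = μ₁` the second factor has the sign of `θ(0)`. -/
theorem e_pos (hμ : 0 < μ.1 / c.θ 0) : 0 < e μ := by
  have hθ := H.θ_ne_zero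
  have h2 : 0 < c.θ 0 * (c.θ μ - c.N μ * e μ) := lt_trans (by positivity) H.secant_large
  have h3 : 0 < μ.1 * c.θ 0 := by
    have : μ.1 * c.θ 0 = μ.1 / c.θ 0 * c.θ 0 ^ 2 := by field_simp
    rw [this]; positivity
  rw [← H.e_mul_secant, mul_assoc, mul_comm _ (c.θ 0)] at h3
  exact (pos_iff_pos_of_mul_pos h3).2 h2

/-- In `e (θ - N e) = μ₁` the second factor exceeds `|θ(0)| / 2` in absolute value. -/
theorem sq_e_le : e μ ^ 2 ≤ 4 / c.θ 0 ^ 2 * μ.1 ^ 2 := by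
  have hθ := H.θ_ne_zero
  have hpos : 0 < c.θ 0 ^ 2 := by positivity
  have h1 := H.secant_large
  have h2 : (c.θ 0 ^ 2 / 2) ^ 2 ≤ (c.θ 0 * (c.θ μ - c.N μ * e μ)) ^ 2 := by gcongr
  rw [← H.e_mul_secant, div_mul_eq_mul_div, le_div_iff₀ hpos]
  have h3 := mul_le_mul_of_nonneg_left h2 (sq_nonneg (e μ))
  refine le_of_mul_le_mul_right ?_ hpos
  nlinarith

/-- The linearization at `E₁` is triangular. -/
theorem hasFDerivAt_E₁ :
    HasFDerivAt (c.field μ)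
      (planarMap (e μ * (-c.θ μ + 2 * c.N μ * e μ)) (e μ * (c.γ μ - c.M μ * e μ)) 0
        (c.g₂ μ (e μ, 0))) (e μ, 0) := by
  have h := c.hasFDerivAt_field μ (e μ, 0)
  simpa [H.g₁_e] using h

theorem hasFDerivAt_E₃ :
    HasFDerivAt (c.field μ)
      (planarMap ((E₃ μ).1 * (-c.θ μ - c.M μ * (E₃ μ).2 + 2 * c.N μ * (E₃ μ).1))
        ((E₃ μ).1 * (c.γ μ - c.M μ * (E₃ μ).1)) ((E₃ μ).2 * (-c.δ μ + 2 * c.S μ * (E₃ μ).1))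
        ((E₃ μ).2 * (1 + 2 * c.P μ * (E₃ μ).2))) (E₃ μ) := by
  have h := c.hasFDerivAt_field μ (E₃ μ)
  simpa [H.g₁_E₃, H.g₂_E₃] using h

/-- The eigenvalues at the collision of `E₁` and `E₃`. -/
theorem eigenvaluesAt_collision (hk : c.g₂ μ (e μ, 0) = 0) :
    eigenvaluesAt (c.field μ) (e μ, 0) =
      {0, ((e μ * (-c.θ μ + 2 * c.N μ * e μ) : ℝ) : ℂ)} := by
  have h := H.hasFDerivAt_E₁
  rw [hk] at h
  exact eigenvaluesAt_eq_pair h (by simp) (by simp)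

theorem eigenvalue_ne_zero (he : 0 < e μ) : e μ * (-c.θ μ + 2 * c.N μ * e μ) ≠ 0 := by
  refine mul_ne_zero he.ne' fun h => ?_
  have h1 := H.tangent_pos
  have h2 : c.θ μ - 2 * c.N μ * e μ = 0 := by linarith
  simp [h2] at h1

/-- Adding `μ₁ = e (θ - N e)` to the eigenvalue leaves exactly `N e²`. -/
theorem abs_eigenvalue_add_le :
    |e μ * (-c.θ μ + 2 * c.N μ * e μ) + μ.1| ≤ (|c.N 0| + 1) * (4 / c.θ 0 ^ 2) * μ.1 ^ 2 := by
  have h : e μ * (-c.θ μ + 2 * c.N μ * e μ) + μ.1 = c.N μ * e μ ^ 2 := by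
    rw [← H.e_mul_secant]; ring
  rw [h, abs_mul, abs_of_nonneg (sq_nonneg (e μ)), mul_assoc]
  exact mul_le_mul H.N_bound.le H.sq_e_le (sq_nonneg _) (by positivity)

theorem sotomayor (he : 0 < e μ) (hE : E₃ μ = (e μ, 0)) (hk : c.g₂ μ (e μ, 0) = 0) :
    SotomayorTranscritical (fun s => c.field (μ.1, s)) (e μ, 0) μ.2 := by
  have hl := H.eigenvalue_ne_zero he
  have heig := H.eigenvaluesAt_collision hk
  set l : ℝ := e μ * (-c.θ μ + 2 * c.N μ * e μ) with hldef
  have hfield : c.field (μ.1, μ.2) = c.field μ := rfl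
  have hlC : (l : ℂ) ≠ 0 := by exact_mod_cast hl
  have hA : ∀ v : ℝ × ℝ, fderiv ℝ (c.field μ) (e μ, 0) v =
      (l * v.1 + e μ * (c.γ μ - c.M μ * e μ) * v.2, 0) := by
    intro v
    rw [H.hasFDerivAt_E₁.fderiv, planarMap_apply, hk]
    simp [hldef]
  -- At the collision `A = !![l, e (γ - M e); 0, 0]`: its kernel is spanned by this `v`, and the
  -- second coordinate is a left null functional.
  refine ⟨?_, ?_, ?_, (-(e μ * (c.γ μ - c.M μ * e μ)), l), ContinuousLinearMap.snd ℝ ℝ ℝ, ?_, ?_,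
    ?_, ?_, ?_, ?_, ?_⟩
  · simp [field, H.g₁_e]
  · simp only [hfield, heig]
    rw [Multiset.insert_eq_cons, Multiset.count_cons_self, Multiset.count_singleton,
      if_neg hlC.symm]
  · simp only [hfield, heig]
    intro z hz hz0
    simp only [Multiset.insert_eq_cons, Multiset.mem_cons, Multiset.mem_singleton] at hz
    rcases hz with rfl | rfl
    · exact absurd rfl hz0
    · simpa using hl
  · simp [hl]
  · intro h
    have := congrArg (fun w : ℝ × ℝ →L[ℝ] ℝ => w (0, 1)) h
    simp at this
  · simp only [hfield, hA]
    ext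
    · simp; ring
    · simp
  · simp only [hfield]
    ext <;> simp [hA]
  · have hline : ContDiffAt ℝ ∞ (fun s : ℝ => (μ.1, s)) μ.2 :=
      contDiffAt_const.prodMk contDiffAt_id
    have h1 : DifferentiableAt ℝ (fun s => c.g₁ (μ.1, s) (e μ, 0)) μ.2 :=
      (SmoothAt.g₁_comp (m := fun s => (μ.1, s)) (ξ := fun _ => (e μ, 0)) H.smooth hline
        contDiffAt_const).differentiableAt (by simp)
    have h2 : HasDerivAt (fun s => c.field (μ.1, s) (e μ, 0))
        (e μ * deriv (fun s => c.g₁ (μ.1, s) (e μ, 0)) μ.2, 0) μ.2 := by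
      refine HasDerivAt.congr_of_eventuallyEq
        ((h1.hasDerivAt.const_mul (e μ)).prodMk (hasDerivAt_const μ.2 (0 : ℝ)))
        (Eventually.of_forall fun s => ?_)
      simp [field]
    rw [h2.deriv]
    simp
  · have hline : ContDiffAt ℝ ∞ (fun s : ℝ => (μ.1, s)) μ.2 :=
      contDiffAt_const.prodMk contDiffAt_id
    have hcomp : ∀ f : ℝ × ℝ → ℝ, ContDiffAt ℝ ∞ f μ →
        DifferentiableAt ℝ (fun s => f (μ.1, s)) μ.2 := fun f hf =>
      (ContDiffAt.comp (f := fun s : ℝ => (μ.1, s)) μ.2 hf hline).differentiableAt (by simp)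
    obtain ⟨s1, s2, s3, s4, s5, s6, s7⟩ := H.smooth
    have d1 := hcomp _ s1
    have d2 := hcomp _ s2
    have d4 := hcomp _ s4
    have d5 := hcomp _ s5
    have hg : DifferentiableAt ℝ (fun s => c.g₁ (μ.1, s) (e μ, 0)) μ.2 :=
      (SmoothAt.g₁_comp (m := fun s => (μ.1, s)) (ξ := fun _ => (e μ, 0)) H.smooth hline
        contDiffAt_const).differentiableAt (by simp)
    -- The functional `w` reads only the second component; of the first, differentiability is
    -- enough.
    have h1 : DifferentiableAt ℝ (fun s => (c.g₁ (μ.1, s) (e μ, 0) +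
        e μ * (-c.θ (μ.1, s) + 2 * c.N (μ.1, s) * e μ)) * -(e μ * (c.γ μ - c.M μ * e μ)) +
          e μ * (c.γ (μ.1, s) - c.M (μ.1, s) * e μ) * l) μ.2 := by fun_prop
    have h2 := (c.hasDerivAt_g₂_param H.smooth (e μ)).mul_const l
    have h3 : (fun s => fderiv ℝ (c.field (μ.1, s)) (e μ, 0)
        (-(e μ * (c.γ μ - c.M μ * e μ)), l)) = fun s => ((c.g₁ (μ.1, s) (e μ, 0) +
        e μ * (-c.θ (μ.1, s) + 2 * c.N (μ.1, s) * e μ)) * -(e μ * (c.γ μ - c.M μ * e μ)) +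
          e μ * (c.γ (μ.1, s) - c.M (μ.1, s) * e μ) * l, c.g₂ (μ.1, s) (e μ, 0) * l) := by
      funext s
      simp [fderiv_field_apply]
    rw [h3, (h1.hasDerivAt.prodMk h2).deriv]
    exact mul_ne_zero H.deriv_param_pos.ne' hl
  · simp only [hfield]
    set v : ℝ × ℝ := (-(e μ * (c.γ μ - c.M μ * e μ)), l) with hv
    have hG : (fun x => fderiv ℝ (c.field μ) x v) = fun ξ : ℝ × ℝ =>
        ((c.g₁ μ ξ + ξ.1 * (-c.θ μ - c.M μ * ξ.2 + 2 * c.N μ * ξ.1)) * v.1 +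
          ξ.1 * (c.γ μ - c.M μ * ξ.1) * v.2,
        ξ.2 * (-c.δ μ + 2 * c.S μ * ξ.1) * v.1 +
          (c.g₂ μ ξ + ξ.2 * (1 + 2 * c.P μ * ξ.2)) * v.2) :=
      funext fun ξ => c.fderiv_field_apply μ ξ v
    have hp : HasFDerivAt Prod.fst (ContinuousLinearMap.fst ℝ ℝ ℝ) (e μ, (0 : ℝ)) :=
      hasFDerivAt_fst
    have hq : HasFDerivAt Prod.snd (ContinuousLinearMap.snd ℝ ℝ ℝ) (e μ, (0 : ℝ)) :=
      hasFDerivAt_snd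
    have hd1 : DifferentiableAt ℝ (fun ξ : ℝ × ℝ =>
        (c.g₁ μ ξ + ξ.1 * (-c.θ μ - c.M μ * ξ.2 + 2 * c.N μ * ξ.1)) * v.1 +
          ξ.1 * (c.γ μ - c.M μ * ξ.1) * v.2) (e μ, 0) := by
      have := (c.hasFDerivAt_g₁ μ (e μ, 0)).differentiableAt
      fun_prop
    have hd2 := ((hq.mul (((hp.const_mul (2 * c.S μ))).const_add (-c.δ μ))).mul_const v.1).add
      (((c.hasFDerivAt_g₂ μ (e μ, 0)).add
        (hq.mul ((hq.const_mul (2 * c.P μ)).const_add 1))).mul_const v.2)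
    have hd := hd1.hasFDerivAt.prodMk hd2
    rw [hG]
    have hfd : fderiv ℝ (fun ξ : ℝ × ℝ =>
        ((c.g₁ μ ξ + ξ.1 * (-c.θ μ - c.M μ * ξ.2 + 2 * c.N μ * ξ.1)) * v.1 +
          ξ.1 * (c.γ μ - c.M μ * ξ.1) * v.2,
        ξ.2 * (-c.δ μ + 2 * c.S μ * ξ.1) * v.1 +
          (c.g₂ μ ξ + ξ.2 * (1 + 2 * c.P μ * ξ.2)) * v.2)) (e μ, 0) = _ := hd.fderiv
    rw [hfd]
    -- The coefficient is `2 l ((-δ + 2 S e) v₁ + l)`; inserting `v₁` and `l` gives `2 l e` times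
    -- `crossDen`, evaluated at `E₃ = (e, 0)`.
    have hval : 2 * l * e μ * c.crossDen e E₃ μ ≠ 0 :=
      mul_ne_zero (mul_ne_zero (mul_ne_zero two_ne_zero hl) he.ne') H.den_ne_zero
    convert hval using 1
    simp [crossDen, hE, hv, hldef]
    ring

end Regular

end Crossing

end Coeffs

/-! ### Exchange of stability and the local picture at the collision. -/

namespace Coeffs

variable {c : Coeffs} {e : ℝ × ℝ → ℝ} {E₃ : ℝ × ℝ → ℝ × ℝ} {μ : ℝ × ℝ}

namespace Regular

variable (H : c.Regular e E₃ μ)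

include H

/-- The determinant of the linearization at `E₃` has the sign of `θ(0) g₂(E₁)`. -/
theorem exists_det_E₃ : ∃ m > 0, (E₃ μ).2 * c.jacE₃ E₃ μ = c.θ 0 * c.g₂ μ (e μ, 0) * m := by
  have hθ := H.θ_ne_zero
  have hden := H.den_ne_zero
  -- Substitute `(E₃)₂ = k · crossNum / crossDen` and multiply numerator and denominator by `θ(0)² ·
  -- crossDen`, so that only known positive products remain besides `θ(0) k`.
  refine ⟨c.θ 0 * c.crossNum e E₃ μ * (c.crossDen e E₃ μ * c.jacE₃ E₃ μ) /
    (c.θ 0 ^ 2 * c.crossDen e E₃ μ ^ 2),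
    div_pos (mul_pos H.num_pos H.den_jac_pos) (by positivity), ?_⟩
  field_simp
  linear_combination c.jacE₃ E₃ μ * H.snd_E₃_mul_den

/-- If the trace at `E₃` has the sign of `-θ(0)`, then away from the curve both equilibria are
hyperbolic, with stability indices determined by the signs of `θ(0)` and `g₂(E₁)`. -/
theorem hyperbolic_and_index (he : 0 < e μ) (hE : 0 < (E₃ μ).1)
    (htr : c.θ 0 * ((E₃ μ).1 * (-c.θ μ - c.M μ * (E₃ μ).2 + 2 * c.N μ * (E₃ μ).1) +
      (E₃ μ).2 * (1 + 2 * c.P μ * (E₃ μ).2)) < 0) (hk : c.g₂ μ (e μ, 0) ≠ 0) :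
    IsHyperbolicAt (c.field μ) (e μ, 0) ∧ IsHyperbolicAt (c.field μ) (E₃ μ) ∧
    stableIndex (c.field μ) (e μ, 0) =
      (if 0 < c.θ 0 then 1 else 0) + (if c.g₂ μ (e μ, 0) < 0 then 1 else 0) ∧
    stableIndex (c.field μ) (E₃ μ) =
      (if 0 < c.θ 0 then 1 else 0) + (if c.g₂ μ (e μ, 0) < 0 then 0 else 1) := by
  have hd1 := H.hasFDerivAt_E₁
  have hd3 := H.hasFDerivAt_E₃
  obtain ⟨m, hm, hdet⟩ := H.exists_det_E₃
  -- At `E₃` the rows of the linearization are `ξ₁ ∇g₁` and `ξ₂ ∇g₂`, so its determinant is `ξ₁ ξ₂`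
  -- times the Jacobian of `(g₁, g₂)`.
  have hdet3 : (E₃ μ).1 * (-c.θ μ - c.M μ * (E₃ μ).2 + 2 * c.N μ * (E₃ μ).1) *
      ((E₃ μ).2 * (1 + 2 * c.P μ * (E₃ μ).2)) -
      (E₃ μ).1 * (c.γ μ - c.M μ * (E₃ μ).1) * ((E₃ μ).2 * (-c.δ μ + 2 * c.S μ * (E₃ μ).1)) =
      (E₃ μ).1 * (c.θ 0 * c.g₂ μ (e μ, 0) * m) := by
    rw [← hdet, jacE₃]; ring
  have htan := H.tangent_pos
  set k := c.g₂ μ (e μ, 0)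
  rcases lt_or_gt_of_ne H.θ_ne_zero with hθ | hθ
  · have ha : 0 < e μ * (-c.θ μ + 2 * c.N μ * e μ) := mul_pos he (by nlinarith)
    have ht := (neg_iff_pos_of_mul_neg htr).1 hθ
    rcases lt_or_gt_of_ne hk with hk | hk
    · have r1 := saddle_of_det_neg hd1 (by nlinarith)
      have r3 := source_of_det_pos_of_trace_pos hd3
        (by rw [hdet3]; exact mul_pos hE (mul_pos (mul_pos_of_neg_of_neg hθ hk) hm)) ht
      exact ⟨r1.1, r3.1, by simp [r1.2, hθ.not_gt, hk], by simp [r3.2, hθ.not_gt, hk]⟩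
    · have r1 := source_of_det_pos_of_trace_pos hd1 (by nlinarith [mul_pos ha hk])
        (add_pos ha hk)
      have r3 := saddle_of_det_neg hd3
        (by rw [hdet3]
            exact mul_neg_of_pos_of_neg hE
              (mul_neg_of_neg_of_pos (mul_neg_of_neg_of_pos hθ hk) hm))
      exact ⟨r1.1, r3.1, by simp [r1.2, hθ.not_gt, hk.not_gt], by simp [r3.2, hθ.not_gt, hk.not_gt]⟩
  · have ha : e μ * (-c.θ μ + 2 * c.N μ * e μ) < 0 := mul_neg_of_pos_of_neg he (by nlinarith)
    have ht := (pos_iff_neg_of_mul_neg htr).1 hθ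
    rcases lt_or_gt_of_ne hk with hk | hk
    · have r1 := sink_of_det_pos_of_trace_neg hd1 (by nlinarith [mul_pos_of_neg_of_neg ha hk])
        (add_neg ha hk)
      have r3 := saddle_of_det_neg hd3
        (by rw [hdet3]
            exact mul_neg_of_pos_of_neg hE
              (mul_neg_of_neg_of_pos (mul_neg_of_pos_of_neg hθ hk) hm))
      exact ⟨r1.1, r3.1, by simp [r1.2, hθ, hk], by simp [r3.2, hθ, hk]⟩
    · have r1 := saddle_of_det_neg hd1 (by nlinarith [mul_neg_of_neg_of_pos ha hk])
      have r3 := sink_of_det_pos_of_trace_neg hd3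
        (by rw [hdet3]; exact mul_pos hE (mul_pos (mul_pos hθ hk) hm)) ht
      exact ⟨r1.1, r3.1, by simp [r1.2, hθ, hk.not_gt], by simp [r3.2, hθ, hk.not_gt]⟩

end Regular

theorem hasDerivAt_param_line (μ : ℝ × ℝ) :
    HasDerivAt (fun s : ℝ => (μ.1, s)) ((0 : ℝ), (1 : ℝ)) μ.2 :=
  (hasDerivAt_const _ _).prodMk (hasDerivAt_id _)

theorem tendsto_param_line (μ : ℝ × ℝ) : Tendsto (fun s : ℝ => (μ.1, s)) (𝓝 μ.2) (𝓝 μ) :=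
  (hasDerivAt_param_line μ).continuousAt

theorem differentiableAt_comp_param_line {F : Type*} [NormedAddCommGroup F] [NormedSpace ℝ F]
    {f : ℝ × ℝ → F} {μ : ℝ × ℝ} (hf : DifferentiableAt ℝ f μ) :
    DifferentiableAt ℝ (fun s => f (μ.1, s)) μ.2 :=
  (hf.hasFDerivAt.comp_hasDerivAt μ.2 (hasDerivAt_param_line μ)).differentiableAt

/-- The two branches leave the collision with different velocities. -/
theorem deriv_branches_ne (hreg : ∀ᶠ ν in 𝓝 μ, c.Regular e E₃ ν) (hE : E₃ μ = (e μ, 0))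
    (hk : c.g₂ μ (e μ, 0) = 0) :
    deriv (fun s => (e (μ.1, s), (0 : ℝ))) μ.2 ≠ deriv (fun s => E₃ (μ.1, s)) μ.2 := by
  have H := hreg.self_of_nhds
  obtain ⟨s1, s2, s3, s4, s5, s6, s7⟩ := H.smooth
  have hd : ∀ {F : Type} [NormedAddCommGroup F] [NormedSpace ℝ F] {f : ℝ × ℝ → F},
      ContDiffAt ℝ ∞ f μ → DifferentiableAt ℝ f μ := fun h => h.differentiableAt (by simp)
  have d1 := hd s1
  have d2 := hd s2
  have d3 := hd s3
  have d4 := hd s4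
  have d5 := hd s5
  have d6 := hd s6
  have d7 := hd s7
  have de := hd H.smooth_e
  have dE := hd H.smooth_E₃
  have dnum : DifferentiableAt ℝ (fun ν => c.crossNum e E₃ ν) μ := by
    unfold crossNum; fun_prop
  have dden : DifferentiableAt ℝ (fun ν => c.crossDen e E₃ ν) μ := by
    unfold crossDen; fun_prop
  have dk : DifferentiableAt ℝ (fun ν => c.g₂ ν (e ν, 0)) μ :=
    hd (H.smooth.g₂_comp contDiffAt_id (H.smooth_e.prodMk contDiffAt_const))
  have hk' := dk.hasFDerivAt.comp_hasDerivAt μ.2 (hasDerivAt_param_line μ)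
  have hE' := (differentiableAt_comp_param_line dE).hasDerivAt
  have hp' := (differentiableAt_comp_param_line de).hasDerivAt.prodMk (hasDerivAt_const μ.2 (0 : ℝ))
  have hnum' := (differentiableAt_comp_param_line dnum).hasDerivAt
  have hden' := (differentiableAt_comp_param_line dden).hasDerivAt
  have hE2 : HasDerivAt (fun s => (E₃ (μ.1, s)).2) (deriv (fun s => E₃ (μ.1, s)) μ.2).2 μ.2 :=
    (ContinuousLinearMap.snd ℝ ℝ ℝ).hasFDerivAt.comp_hasDerivAt μ.2 hE'
  have hlhs := hE2.mul hden'
  have hrhs := hk'.mul hnum'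
  -- Differentiate `snd_E₃_mul_den` in `μ₂`: `(E₃)₂` and `g₂(E₁)` both vanish at `μ`, so one term of
  -- each product rule survives. Hence `E₃` leaves the axis with nonzero speed while `E₁` stays on
  -- it.
  have heq : (deriv (fun s => E₃ (μ.1, s)) μ.2).2 * c.crossDen e E₃ μ =
      fderiv ℝ (fun ν => c.g₂ ν (e ν, 0)) μ (0, 1) * c.crossNum e E₃ μ := by
    have := hlhs.unique (hrhs.congr_of_eventuallyEq ?_)
    · simpa [hE, hk] using this
    · filter_upwards [(tendsto_param_line μ).eventually hreg] with s hs
      exact hs.snd_E₃_mul_den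
  intro h
  rw [hp'.deriv] at h
  rw [← h, zero_mul, eq_comm] at heq
  exact mul_ne_zero H.deriv_total_pos.ne' H.num_ne_zero heq

theorem isTranscritical_of_regular {ε r : ℝ} (hreg : ∀ ν ∈ Metric.ball 0 ε, c.Regular e E₃ ν)
    (h1 : c.IsE₁ e ε r) (h3 : c.IsE₃ E₃ ε r) (hμ : μ ∈ Metric.ball 0 ε) (he : 0 < e μ)
    (hE : E₃ μ = (e μ, 0)) (hk : c.g₂ μ (e μ, 0) = 0) :
    IsTranscritical (fun s => c.field (μ.1, s))
      (fun s => (e (μ.1, s), 0)) (fun s => E₃ (μ.1, s)) (e μ, 0) μ.2 := by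
  have hball : ∀ᶠ ν in 𝓝 μ, ν ∈ Metric.ball (0 : ℝ × ℝ) ε := Metric.isOpen_ball.mem_nhds hμ
  have H := hreg μ hμ
  have her := (h1.2 μ hμ).1
  -- `R ≤ e μ` keeps the ball in `ξ₁ > 0`, away from equilibria with `ξ₁ = 0`; `R ≤ r - e μ` keeps
  -- it where `e` and `E₃` are the unique solutions.
  set R : ℝ := min (e μ) (r - e μ) with hR
  have hRpos : 0 < R := lt_min he (by linarith [her.2])
  have ce := H.smooth_e.continuousAt
  have cE := H.smooth_E₃.continuousAt
  obtain ⟨s1, s2, s3, s4, s5, s6, s7⟩ := H.smooth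
  have vp : ∀ᶠ ν in 𝓝 μ, (e ν, (0 : ℝ)) ∈ Metric.ball (e μ, (0 : ℝ)) R :=
    (ce.prodMk continuousAt_const).eventually (Metric.ball_mem_nhds _ hRpos)
  have vq : ∀ᶠ ν in 𝓝 μ, E₃ ν ∈ Metric.ball (e μ, (0 : ℝ)) R :=
    cE.eventually (by rw [hE]; exact Metric.ball_mem_nhds _ hRpos)
  -- The trace vanishes at `μ = 0`, so its sign cannot be part of `Regular`. At the collision it
  -- equals the nonzero eigenvalue, and the sign persists only near the given `μ`.
  have vtr : ∀ᶠ ν in 𝓝 μ, c.θ 0 *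
      ((E₃ ν).1 * (-c.θ ν - c.M ν * (E₃ ν).2 + 2 * c.N ν * (E₃ ν).1) +
        (E₃ ν).2 * (1 + 2 * c.P ν * (E₃ ν).2)) < 0 := by
    have c1 := s1.continuousAt
    have c4 := s4.continuousAt
    have c5 := s5.continuousAt
    have c7 := s7.continuousAt
    have cE1 : ContinuousAt (fun ν => (E₃ ν).1) μ := cE.fst
    have cE2 : ContinuousAt (fun ν => (E₃ ν).2) μ := cE.snd
    have hcont : ContinuousAt (fun ν => c.θ 0 *
      ((E₃ ν).1 * (-c.θ ν - c.M ν * (E₃ ν).2 + 2 * c.N ν * (E₃ ν).1) +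
        (E₃ ν).2 * (1 + 2 * c.P ν * (E₃ ν).2))) μ := by fun_prop
    refine hcont.eventually_lt_const ?_
    simp only [hE]
    nlinarith [mul_pos he H.tangent_pos]
  have vsign : ∀ᶠ s in 𝓝 μ.2,
      SignType.sign (c.g₂ (μ.1, s) (e (μ.1, s), 0)) = SignType.sign (s - μ.2) := by
    have dk : DifferentiableAt ℝ (fun ν => c.g₂ ν (e ν, 0)) μ :=
      (H.smooth.g₂_comp contDiffAt_id (H.smooth_e.prodMk contDiffAt_const)).differentiableAt
        (by simp)
    have hk' : HasDerivAt (fun s => c.g₂ (μ.1, s) (e (μ.1, s), 0))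
        (fderiv ℝ (fun ν => c.g₂ ν (e ν, 0)) μ (0, 1)) μ.2 := by
      have := dk.hasFDerivAt.comp_hasDerivAt μ.2 (hasDerivAt_param_line μ)
      exact this
    exact eventually_nhdsWithin_sign_eq_of_deriv_pos
      (by rw [hk'.deriv]; exact H.deriv_total_pos) hk
  obtain ⟨ρ, hρ, hev⟩ := Metric.eventually_nhds_iff_ball.1
    (((tendsto_param_line μ).eventually (hball.and (vp.and (vq.and vtr)))).and vsign)
  rw [Real.ball_eq_Ioo] at hev
  have hRball : ∀ x ∈ Metric.ball (e μ, (0 : ℝ)) R, 0 < x.1 ∧ x.1 ∈ Set.Ioo (-r) r ∧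
      x ∈ Metric.ball (0 : ℝ × ℝ) r := by
    rintro ⟨x, y⟩ hx
    rw [Metric.mem_ball, Prod.dist_eq, max_lt_iff, Real.dist_eq, Real.dist_eq, abs_lt, abs_lt] at hx
    have hR1 : R ≤ e μ := min_le_left _ _
    have hR2 : R ≤ r - e μ := min_le_right _ _
    simp only [sub_zero] at hx
    obtain ⟨⟨a1, a2⟩, a3, a4⟩ := hx
    refine ⟨by simp only; linarith, ⟨by simp only; linarith, by simp only; linarith⟩, ?_⟩
    rw [Metric.mem_ball, Prod.dist_eq, max_lt_iff, Real.dist_eq, Real.dist_eq, abs_lt, abs_lt]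
    simp only [Prod.fst_zero, Prod.snd_zero, sub_zero]
    refine ⟨⟨?_, ?_⟩, ?_, ?_⟩ <;> linarith
  have hmaps : Set.MapsTo (fun s : ℝ => (μ.1, s)) (Set.Ioo (μ.2 - ρ) (μ.2 + ρ))
      (Metric.ball 0 ε) := fun s hs => (hev s hs).1.1
  have hline : ContDiffOn ℝ ∞ (fun s : ℝ => (μ.1, s)) (Set.Ioo (μ.2 - ρ) (μ.2 + ρ)) :=
    (contDiff_const.prodMk contDiff_id).contDiffOn
  have hindex : ∀ s ∈ Set.Ioo (μ.2 - ρ) (μ.2 + ρ), s ≠ μ.2 → _ := fun s hs hne =>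
    (hreg (μ.1, s) (hev s hs).1.1).hyperbolic_and_index
      (hRball _ (hev s hs).1.2.1).1 (hRball _ (hev s hs).1.2.2.1).1 (hev s hs).1.2.2.2
      (by
        rw [← sign_ne_zero, (hev s hs).2, sign_ne_zero]
        exact sub_ne_zero.2 hne)
  refine ⟨rfl, hE, deriv_branches_ne (hball.mono hreg) hE hk, ρ, hρ, R, hRpos,
    (h1.1.comp hline hmaps).prodMk contDiffOn_const, h3.1.comp hline hmaps, ?_,
    -- For `μ₂` below the critical value `g₂(E₁) < 0`, so `E₁` has one more stable direction than
    -- `E₃`.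
    (if 0 < c.θ 0 then 1 else 0) + 1, (if 0 < c.θ 0 then 1 else 0) + 0, Or.inl (by ring), ?_, ?_⟩
  · intro s hs
    obtain ⟨⟨hb, hp, hq, -⟩, hsg⟩ := hev s hs
    have Hs := hreg _ hb
    refine ⟨hp, hq, fun x hx => ?_, fun hne => ⟨fun heq => ?_, (hindex s hs hne).1,
      (hindex s hs hne).2.1⟩⟩
    · obtain ⟨x0, x1, x2⟩ := hRball x hx
      constructor
      · intro hF
        simp only [field, Prod.mk_eq_zero, mul_eq_zero] at hF
        have hg1 := hF.1.resolve_left x0.ne'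
        rcases hF.2 with hF2 | hF2
        · left
          refine Prod.ext (((h1.2 _ hb).2 x.1 x1).1 ?_) hF2
          simpa [g₁, hF2] using hg1
        · right
          exact ((h3.2 _ hb).2 x x2).1 ⟨hg1, hF2⟩
      · rintro (rfl | rfl)
        · simp [field, Hs.g₁_e]
        · simp [field, Hs.g₁_E₃, Hs.g₂_E₃]
    · have h0 : c.g₂ (μ.1, s) (e (μ.1, s), 0) = 0 :=
        Hs.snd_E₃_eq_zero_iff.1 (congrArg Prod.snd heq).symm
      rw [h0, sign_zero, eq_comm, sign_eq_zero_iff, sub_eq_zero] at hsg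
      exact hne hsg
  · intro s hs
    have hs' : s ∈ Set.Ioo (μ.2 - ρ) (μ.2 + ρ) := ⟨hs.1, hs.2.trans (by linarith)⟩
    have hneg : c.g₂ (μ.1, s) (e (μ.1, s), 0) < 0 := by
      rw [← sign_eq_neg_one_iff, (hev s hs').2, sign_eq_neg_one_iff]
      exact sub_neg.2 hs.2
    have := (hindex s hs' hs.2.ne).2.2
    rwa [if_pos hneg, if_pos hneg] at this
  · intro s hs
    have hs' : s ∈ Set.Ioo (μ.2 - ρ) (μ.2 + ρ) := ⟨lt_trans (by linarith) hs.1, hs.2⟩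
    have hpos : 0 < c.g₂ (μ.1, s) (e (μ.1, s), 0) := by
      rw [← sign_eq_one_iff, (hev s hs').2, sign_eq_one_iff]
      exact sub_pos.2 hs.1
    have := (hindex s hs' hs.1.ne').2.2
    rwa [if_neg hpos.not_gt, if_neg hpos.not_gt] at this

end Coeffs

end KolmogorovTranscritical

/-! ### Choice of the radii and assembly. -/

open KolmogorovTranscritical in
open scoped ContDiff in
theorem mainTheorem2 (c : Coeffs) (U : Set (ℝ × ℝ)) (hU : IsOpen U) (h0 : (0 : ℝ × ℝ) ∈ U)
    (hc : c.SmoothOn U)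
    (hθδ : c.θ 0 * c.δ 0 ≠ 0) (hθγδ : c.θ 0 - c.γ 0 * c.δ 0 ≠ 0) :
    ∃ ε > 0, ∃ r > 0, ∃ (e : ℝ × ℝ → ℝ) (E₃ : ℝ × ℝ → ℝ × ℝ) (h : ℝ → ℝ) (K : ℝ),
      Metric.ball (0 : ℝ × ℝ) ε ⊆ U ∧ c.IsE₁ e ε r ∧ c.IsE₃ E₃ ε r ∧
      -- `T₁` is a smooth curve `μ₂ = (δ/θ) μ₁ + O(μ₁²)`, `μ₁/θ > 0`
      ContDiffOn ℝ ∞ h (Set.Ioo (-ε) ε) ∧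
      (∀ t ∈ Set.Ioo (-ε) ε, |h t - c.δ 0 / c.θ 0 * t| ≤ K * t ^ 2) ∧
      c.T₁ E₃ ε = {μ | μ ∈ Metric.ball (0 : ℝ × ℝ) ε ∧ μ.2 = h μ.1 ∧ 0 < μ.1 / c.θ 0} ∧
      ∀ μ ∈ c.T₁ E₃ ε,
        -- `E₃` and `E₁` collide, with eigenvalues `0` and `-μ₁ + O(μ₁²) ≠ 0`
        0 < e μ ∧ E₃ μ = (e μ, 0) ∧
        (∃ l : ℝ, l ≠ 0 ∧ |l + μ.1| ≤ K * μ.1 ^ 2 ∧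
          eigenvaluesAt (c.field μ) (e μ, 0) = {0, (l : ℂ)}) ∧
        -- with `μ₁` fixed, the system has a transcritical bifurcation as `μ₂` crosses `T₁`
        SotomayorTranscritical (fun s => c.field (μ.1, s)) (e μ, 0) μ.2 ∧
        IsTranscritical (fun s => c.field (μ.1, s))
          (fun s => (e (μ.1, s), 0)) (fun s => E₃ (μ.1, s)) (e μ, 0) μ.2 := by
  have hθ : c.θ 0 ≠ 0 := left_ne_zero_of_mul hθδ
  have hs : ∀ᶠ μ in 𝓝 0, c.SmoothAt μ := by
    filter_upwards [hU.mem_nhds h0] with μ hμ using hc.smoothAt hU hμ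
  obtain ⟨e, he0, hes, heiff⟩ := Coeffs.exists_e hs hθ
  obtain ⟨E₃, hE0, hEs, hEiff⟩ := Coeffs.exists_E₃ hs hθγδ
  obtain ⟨h, hhs, hhiff, K, hK⟩ := Coeffs.exists_curve hs he0 hes heiff hθ
  have hreg := Coeffs.eventually_regular hs hθ hθγδ he0 hes heiff hE0 hEs hEiff
  obtain ⟨r₁, hr₁, hr₁iff⟩ := Metric.eventually_nhds_iff_ball.1 heiff
  obtain ⟨r₃, hr₃, hr₃iff⟩ := Metric.eventually_nhds_iff_ball.1 hEiff
  set r := min r₁ r₃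
  have hr : 0 < r := lt_min hr₁ hr₃
  have her : ∀ᶠ μ in 𝓝 0, e μ ∈ Set.Ioo (-r) r :=
    hes.self_of_nhds.continuousAt.eventually
      (by rw [he0]; exact Ioo_mem_nhds (by linarith) hr)
  have hEr : ∀ᶠ μ in 𝓝 0, E₃ μ ∈ Metric.ball (0 : ℝ × ℝ) r :=
    hEs.self_of_nhds.continuousAt.eventually (by rw [hE0]; exact Metric.ball_mem_nhds _ hr)
  have hUev : ∀ᶠ μ in 𝓝 0, μ ∈ U := hU.mem_nhds h0
  obtain ⟨ε₁, hε₁, hall⟩ := Metric.eventually_nhds_iff_ball.1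
    (hUev.and (hreg.and (her.and (hEr.and hhiff))))
  obtain ⟨ε₂, hε₂, hhall⟩ := Metric.eventually_nhds_iff_ball.1 (hhs.and hK)
  -- `ε ≤ r` because uniqueness was obtained on balls of the product space, whose sup norm also
  -- constrains `μ`.
  set ε := min r (min ε₁ ε₂)
  have hε : 0 < ε := lt_min hr (lt_min hε₁ hε₂)
  have hεr : ε ≤ r := min_le_left _ _
  have hε1 : ε ≤ ε₁ := (min_le_right _ _).trans (min_le_left _ _)
  have hε2 : ε ≤ ε₂ := (min_le_right _ _).trans (min_le_right _ _)
  replace hall := fun μ (hμ : μ ∈ Metric.ball (0 : ℝ × ℝ) ε) =>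
    hall μ (Metric.ball_subset_ball hε1 hμ)
  have hcurve : ∀ t ∈ Set.Ioo (-ε) ε,
      ContDiffAt ℝ ∞ h t ∧ |h t - c.δ 0 / c.θ 0 * t| ≤ K * t ^ 2 := by
    intro t ht
    refine hhall t (Metric.ball_subset_ball hε2 ?_)
    rwa [Real.ball_eq_Ioo, zero_sub, zero_add]
  have h1 : c.IsE₁ e ε r := by
    refine ⟨fun μ hμ => (hall μ hμ).2.1.smooth_e.contDiffWithinAt, fun μ hμ =>
      ⟨(hall μ hμ).2.2.1, fun x hx => ?_⟩⟩
    have hmem : (μ, x) ∈ Metric.ball (0 : (ℝ × ℝ) × ℝ) r₁ := by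
      have hr' : r ≤ r₁ := min_le_left _ _
      rw [Metric.mem_ball, Prod.dist_eq, max_lt_iff]
      refine ⟨lt_of_lt_of_le hμ (hεr.trans hr'), ?_⟩
      rw [Real.dist_eq, Prod.snd_zero, sub_zero]
      exact lt_of_lt_of_le (abs_lt.2 hx) hr'
    simpa [Coeffs.g₁] using hr₁iff _ hmem
  have h3 : c.IsE₃ E₃ ε r := by
    refine ⟨fun μ hμ => (hall μ hμ).2.1.smooth_E₃.contDiffWithinAt, fun μ hμ =>
      ⟨(hall μ hμ).2.2.2.1, fun ξ hξ => ?_⟩⟩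
    have hr' : r ≤ r₃ := min_le_right _ _
    refine hr₃iff (μ, ξ) ?_
    rw [Metric.mem_ball, Prod.dist_eq, max_lt_iff]
    exact ⟨lt_of_lt_of_le hμ (hεr.trans hr'), lt_of_lt_of_le hξ hr'⟩
  -- One constant must serve both quadratic bounds, for `h` and for the eigenvalue.
  refine ⟨ε, hε, r, hr, e, E₃, h, max K ((|c.N 0| + 1) * (4 / c.θ 0 ^ 2)),
    fun μ hμ => (hall μ hμ).1, h1, h3, fun t ht => (hcurve t ht).1.contDiffWithinAt,
    fun t ht => (hcurve t ht).2.trans (by gcongr; exact le_max_left _ _), ?_, ?_⟩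
  · ext μ
    refine and_congr_right fun hμ => and_congr_left fun _ => ?_
    exact (hall μ hμ).2.1.snd_E₃_eq_zero_iff.trans (hall μ hμ).2.2.2.2
  · rintro μ ⟨hμ, hE2, hpos⟩
    have H := (hall μ hμ).2.1
    have he := H.e_pos hpos
    have hk : c.g₂ μ (e μ, 0) = 0 := H.snd_E₃_eq_zero_iff.1 hE2
    -- Once its second coordinate vanishes, `E₃` solves the axis equation, and uniqueness of `e`
    -- applies.
    have hE : E₃ μ = (e μ, 0) := by
      refine Prod.ext (((h1.2 μ hμ).2 _ ?_).1 ?_) hE2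
      · have := (hall μ hμ).2.2.2.1
        rw [Metric.mem_ball, Prod.dist_eq, max_lt_iff, Real.dist_eq, Prod.fst_zero, sub_zero] at this
        exact abs_lt.1 this.1
      · simpa [Coeffs.g₁, hE2] using H.g₁_E₃
    exact ⟨he, hE, ⟨_, H.eigenvalue_ne_zero he,
      H.abs_eigenvalue_add_le.trans (by gcongr; exact le_max_right _ _),
      H.eigenvaluesAt_collision hk⟩, H.sotomayor he hE hk,
      Coeffs.isTranscritical_of_regular (fun ν hν => (hall ν hν).2.1) h1 h3 hμ he hE hk⟩
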